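/- Let $\mathcal H,\mathcal G$ be real Hilbert spaces, $A:\mathcal H\rightrightarrows\mathcal H$ and $B:\mathcal G\rightrightarrows\mathcal G$ maximally monotone set-valued operators, $C:\mathcal H\to\mathcal H$ an $\eta$-cocoercive operator with $\eta>0$ (that is, $\langle x-y,Cx-Cy\rangle\ge\eta\|Cx-Cy\|^2$ for all $x,y\in\mathcal H$), and $L:\mathcal H\to\mathcal G$ a continuous linear operator with adjoint $L^*$. Call $(x,v)\in\mathcal H\times\mathcal G$ a primal-dual solution if $-L^*v\in Ax+Cx$ and $v\in B(Lx)$, and assume that at least one primal-dual solution exists. For a real Hilbert space $\mathcal E$ let $\mathcal S_+(\mathcal E)$ be the set of continuous, linear, self-adjoint, positive semidefinite operators on $\mathcal E$; write $U_1\succcurlyeq U_2$ if $\langle x,U_1x\rangle\ge\langle x,U_2x\rangle$ for all $x\in\mathcal E$; and for $\alpha>0$ let $\mathcal P_\alpha(\mathcal E)=\{U\in\mathcal S_+(\mathcal E):U\succcurlyeq\alpha\,\mathrm{Id}\}$. Let $c>0$ and, for every $k\ge0$, let $M_1^k\in\mathcal S_+(\mathcal H)$ and $M_2^k\in\mathcal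 S_+(\mathcal G)$ be such that $cL^*L+M_1^k\in\mathcal P_{\alpha_k}(\mathcal H)$ for some $\alpha_k>0$. Let $(x^0,z^0,y^0)\in\mathcal H\times\mathcal G\times\mathcal G$ be arbitrary and let $(x^k,z^k,y^k)_{k\ge0}$ be generated by \begin{align*} x^{k+1}&=\left(cL^*L+M_1^k+A\right)^{-1}\left[cL^*(z^k-c^{-1}y^k)+M_1^kx^k-Cx^k\right],\\ z^{k+1}&=\left(\mathrm{Id}+c^{-1}M_2^k+c^{-1}B\right)^{-1}\left[Lx^{k+1}+c^{-1}y^k+c^{-1}M_2^kz^k\right],\\ y^{k+1}&=y^k+c\,(Lx^{k+1}-z^{k+1}). \end{align*} Assume that $M_1^k-\frac1{2\eta}\mathrm{Id}\in\mathcal S_+(\mathcal H)$, $M_1^k\succcurlyeq M_1^{k+1}$ and $M_2^k\succcurlyeq M_2^{k+1}$ for all $k\ge0$, and that one of the following holds: (I) there exists $\alpha_1>0$ such that $M_1^k-\frac1{2\eta}\mathrm{Id}\in\mathcal P_{\alpha_1}(\mathcal H)$ for all $k\ge0$; (II) there exist $\alpha,\alpha_2>0$ such that $L^*L\in\mathcal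 P_\alpha(\mathcal H)$ and $M_2^k\in\mathcal P_{\alpha_2}(\mathcal G)$ for all $k\ge0$. Then there exists a primal-dual solution $(x,v)$ such that $(x^k,z^k,y^k)_{k\ge0}$ converges weakly to $(x,Lx,v)$ in $\mathcal H\times\mathcal G\times\mathcal G$. -/

import Mathlib

namespace MonotoneInclusion

open scoped RealInnerProductSpace

section Operators

variable {E : Type*} [NormedAddCommGroup E] [InnerProductSpace ℝ E]

/-- A set-valued operator `A : E ⇉ E` is monotone if `⟪x - y, u - v⟫ ≥ 0` for all
`(x, u)` and `(y, v)` in its graph. -/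
def IsMonotone (A : E → Set E) : Prop :=
  ∀ ⦃x u y v : E⦄, u ∈ A x → v ∈ A y → 0 ≤ ⟪x - y, u - v⟫

/-- A monotone operator is maximally monotone if its graph has no proper monotone extension. -/
def IsMaximallyMonotone (A : E → Set E) : Prop :=
  IsMonotone A ∧ ∀ A' : E → Set E, IsMonotone A' → (∀ x, A x ⊆ A' x) → A' = A

/-- A single-valued operator `C : E → E` is `η`-cocoercive if
`⟪x - y, C x - C y⟫ ≥ η ‖C x - C y‖ ^ 2` for all `x`, `y`. -/
def IsCocoercive (η : ℝ) (C : E → E) : Prop :=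
  ∀ x y : E, η * ‖C x - C y‖ ^ 2 ≤ ⟪x - y, C x - C y⟫

/-- The inverse of a set-valued operator: `x ∈ A⁻¹ u` if and only if `u ∈ A x`. -/
def inverse (A : E → Set E) : E → Set E := fun u => {x | u ∈ A x}

/-- The sum `T + A` of a single-valued operator `T` and a set-valued operator `A`. -/
def addOp (T : E → E) (A : E → Set E) : E → Set E := fun x => {w | ∃ u ∈ A x, w = T x + u}

/-- The scalar multiple `γ A` of a set-valued operator `A`. -/
def smulOp (γ : ℝ) (A : E → Set E) : E → Set E := fun x => {w | ∃ u ∈ A x, w = γ • u}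

/-- The class `P_α(E)`: bounded self-adjoint positive semidefinite operators `U` with
`U ≽ α Id` in the Loewner order. -/
def IsUniformlyPositive (α : ℝ) (U : E →L[ℝ] E) : Prop :=
  U.IsPositive ∧ α • ContinuousLinearMap.id ℝ E ≤ U

end Operators

section Problem

variable {H G : Type*}
  [NormedAddCommGroup H] [InnerProductSpace ℝ H] [CompleteSpace H]
  [NormedAddCommGroup G] [InnerProductSpace ℝ G] [CompleteSpace G]

/-- `(x, v)` is a primal-dual solution of `0 ∈ A x + L* (B (L x)) + C x` and its dual inclusion:
`-L* v ∈ A x + C x` and `v ∈ B (L x)`. -/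
def IsPrimalDualSolution (A : H → Set H) (B : G → Set G) (C : H → H) (L : H →L[ℝ] G)
    (x : H) (v : G) : Prop :=
  -(L.adjoint v) ∈ addOp C A x ∧ v ∈ B (L x)

/-- `(x k, z k, y k)` is a sequence generated by the ADMM-type algorithm with penalty parameter `c`
and variable metrics `M₁ k`, `M₂ k`. -/
structure IsADMMSequence (A : H → Set H) (B : G → Set G) (C : H → H) (L : H →L[ℝ] G)
    (c : ℝ) (M₁ : ℕ → H →L[ℝ] H) (M₂ : ℕ → G →L[ℝ] G)
    (x : ℕ → H) (z y : ℕ → G) : Prop where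
  c_pos : 0 < c
  M₁_pos : ∀ k, (M₁ k).IsPositive
  M₂_pos : ∀ k, (M₂ k).IsPositive
  metric_pos : ∀ k, ∃ α > 0, IsUniformlyPositive α (c • (L.adjoint ∘L L) + M₁ k)
  /-- `x_{k+1} = (c L*L + M₁ + A)⁻¹ [c L* (z_k - c⁻¹ y_k) + M₁ x_k - C x_k]` -/
  x_step : ∀ k, x (k + 1) ∈ inverse (addOp (c • (L.adjoint ∘L L) + M₁ k) A)
    (c • L.adjoint (z k - c⁻¹ • y k) + M₁ k (x k) - C (x k))
  /-- `z_{k+1} = (Id + c⁻¹ M₂ + c⁻¹ B)⁻¹ [L x_{k+1} + c⁻¹ y_k + c⁻¹ M₂ z_k]` -/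
  z_step : ∀ k, z (k + 1) ∈
    inverse (addOp (ContinuousLinearMap.id ℝ G + c⁻¹ • M₂ k) (smulOp c⁻¹ B))
      (L (x (k + 1)) + c⁻¹ • y k + c⁻¹ • M₂ k (z k))
  y_step : ∀ k, y (k + 1) = y k + c • (L (x (k + 1)) - z (k + 1))

end Problem

end MonotoneInclusion

namespace MonotoneInclusion

open scoped RealInnerProductSpace Topology
open Filter

/-! ### Monotone sequences of positive operators. -/

section PositiveOperators

variable {E : Type*} [NormedAddCommGroup E] [InnerProductSpace ℝ E]

/-! The argument is Fejér monotonicity plus Opial's lemma in a variable metric. For a solution `(a,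
v)`, monotonicity of `A` and `B` and cocoercivity of `C` make `energy` at `(x k - a, z k - L a, y k
- v)` decrease (`energy_descent_of_inner_nonneg`). The forward step on `C` costs `1 / (2 * η) * ‖x k
- x (k + 1)‖ ^ 2`, which `M₁ k` absorbs. Hence the iterates are bounded, the residuals vanish and,
under (I) or (II), so do the increments; then `C (x k)` converges strongly.

Weak cluster points are solutions by maximality of `A` and `B`. Two of them coincide: the difference
of their energies is affine in the iterate, and the decreasing metrics converge strongly, so its
limit can be computed along either filter. Ultrafilters play the role of subsequences. -/

/-- Positivity of `T` tested at `w - K⁻¹ • T w`. This turns convergence of quadratic forms into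
strong convergence. -/
theorem norm_sq_apply_le_of_isPositive {T : E →L[ℝ] E} (hT : T.IsPositive) {K : ℝ} (hK : 0 < K)
    (hTK : ∀ v, ⟪v, T v⟫ ≤ K * ‖v‖ ^ 2) (w : E) : ‖T w‖ ^ 2 ≤ K * ⟪w, T w⟫ := by
  have h := hT.inner_nonneg_right (w - K⁻¹ • T w)
  have h1 : ⟪w, T (T w)⟫ = ‖T w‖ ^ 2 := by
    rw [← hT.inner_left_eq_inner_right, real_inner_self_eq_norm_sq]
  simp only [map_sub, map_smul, inner_sub_left, inner_sub_right, real_inner_smul_left,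
    real_inner_smul_right, h1, real_inner_self_eq_norm_sq] at h
  have h2 := hTK (T w)
  have h3 : K⁻¹ * (K⁻¹ * ⟪T w, T (T w)⟫) ≤ K⁻¹ * ‖T w‖ ^ 2 := by
    have : K⁻¹ * ⟪T w, T (T w)⟫ ≤ ‖T w‖ ^ 2 := by
      rw [inv_mul_le_iff₀ hK]; exact h2
    exact mul_le_mul_of_nonneg_left this (inv_nonneg.2 hK.le)
  have h4 : K⁻¹ * ‖T w‖ ^ 2 ≤ ⟪w, T w⟫ := by linarith
  rwa [inv_mul_le_iff₀ hK] at h4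

theorem norm_apply_le_of_isPositive {T : E →L[ℝ] E} (hT : T.IsPositive) {K : ℝ} (hK : 0 < K)
    (hTK : ∀ v, ⟪v, T v⟫ ≤ K * ‖v‖ ^ 2) (w : E) : ‖T w‖ ≤ K * ‖w‖ := by
  have h := norm_sq_apply_le_of_isPositive hT hK hTK w
  have h2 := mul_le_mul_of_nonneg_left (hTK w) hK.le
  refine abs_le_of_sq_le_sq' ?_ (by positivity) |>.2
  nlinarith

theorem inner_apply_le_of_le {S T : E →L[ℝ] E} (h : S ≤ T) (w : E) : ⟪w, S w⟫ ≤ ⟪w, T w⟫ := by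
  have := ((ContinuousLinearMap.le_def S T).1 h).inner_nonneg_right w
  simpa [inner_sub_right] using this

theorem exists_forall_inner_apply_le {M : ℕ → E →L[ℝ] E} (hanti : Antitone M) :
    ∃ K > 0, ∀ k v, ⟪v, M k v⟫ ≤ K * ‖v‖ ^ 2 := by
  refine ⟨‖M 0‖ + 1, by positivity, fun k v => ?_⟩
  have h1 := inner_apply_le_of_le (hanti (Nat.zero_le k)) v
  have h2 := real_inner_le_norm v (M 0 v)
  have h3 := (M 0).le_opNorm v
  have h4 := mul_le_mul_of_nonneg_left h3 (norm_nonneg v)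
  nlinarith [sq_nonneg ‖v‖]

/-- An antitone sequence of positive operators converges in the strong operator topology. -/
theorem exists_tendsto_apply_of_antitone [CompleteSpace E] {M : ℕ → E →L[ℝ] E}
    (hpos : ∀ k, (M k).IsPositive) (hanti : Antitone M) (w : E) :
    ∃ u, Tendsto (fun k => M k w) atTop (𝓝 u) := by
  obtain ⟨K, hK, hMK⟩ := exists_forall_inner_apply_le hanti
  have hq : Tendsto (fun k => ⟪w, M k w⟫) atTop (𝓝 (⨅ k, ⟪w, M k w⟫)) :=
    tendsto_atTop_ciInf (fun m n hmn => inner_apply_le_of_le (hanti hmn) w)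
      ⟨0, by rintro _ ⟨k, rfl⟩; exact (hpos k).inner_nonneg_right w⟩
  have hle : ∀ m n, m ≤ n → ‖M m w - M n w‖ ^ 2 ≤ K * (⟪w, M m w⟫ - ⟪w, M n w⟫) := by
    intro m n hmn
    have := norm_sq_apply_le_of_isPositive ((ContinuousLinearMap.le_def _ _).1 (hanti hmn)) hK
      (fun v => by
        have h1 := hMK m v
        have h2 := (hpos n).inner_nonneg_right v
        simp only [sub_apply, inner_sub_right]
        linarith) w
    simpa [inner_sub_right] using this
  refine cauchySeq_tendsto_of_complete (Metric.cauchySeq_iff'.2 fun ε hε => ?_)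
  obtain ⟨N, hN⟩ := Metric.cauchySeq_iff'.1 hq.cauchySeq (ε ^ 2 / K) (by positivity)
  refine ⟨N, fun n hn => ?_⟩
  have h1 := hN n hn
  rw [Real.dist_eq, abs_sub_comm] at h1
  have h2 := (le_abs_self _).trans_lt h1
  rw [lt_div_iff₀ hK] at h2
  have h3 := hle N n hn
  rw [dist_comm, dist_eq_norm]
  exact lt_of_pow_lt_pow_left₀ 2 hε.le (by linarith)

theorem tendsto_apply_zero_of_antitone {M : ℕ → E →L[ℝ] E} (hpos : ∀ k, (M k).IsPositive)
    (hanti : Antitone M) {u : ℕ → E} (hu : Tendsto u atTop (𝓝 0)) :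
    Tendsto (fun k => M k (u k)) atTop (𝓝 0) := by
  obtain ⟨K, hK, hMK⟩ := exists_forall_inner_apply_le hanti
  exact squeeze_zero_norm (fun k => norm_apply_le_of_isPositive (hpos k) hK (hMK k) (u k))
    (by simpa using hu.norm.const_mul K)

theorem le_inner_of_sub_smul_id_isPositive {T : E →L[ℝ] E} {α : ℝ}
    (h : (T - α • ContinuousLinearMap.id ℝ E).IsPositive) (w : E) : α * ‖w‖ ^ 2 ≤ ⟪w, T w⟫ := by
  have := h.inner_nonneg_right w
  simp only [sub_apply, smul_apply, ContinuousLinearMap.id_apply, inner_sub_right,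
    real_inner_smul_right, real_inner_self_eq_norm_sq] at this
  linarith

end PositiveOperators

section Norm

variable {ι E : Type*} [NormedAddCommGroup E]

theorem norm_le_of_mul_norm_sub_sq_le {α R : ℝ} (hα : 0 < α) {u e : E}
    (h : α * ‖u - e‖ ^ 2 ≤ R) : ‖u‖ ≤ √(R / α) + ‖e‖ := by
  have h1 : ‖u - e‖ ≤ √(R / α) := Real.le_sqrt_of_sq_le (by
    rw [le_div_iff₀ hα, mul_comm]; exact h)
  have h2 := norm_add_le (u - e) e
  rw [sub_add_cancel] at h2
  linarith

theorem tendsto_zero_of_mul_norm_sq_le {l : Filter ι} {u : ι → E} {f : ι → ℝ} {α : ℝ}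
    (hα : 0 < α) (hle : ∀ i, α * ‖u i‖ ^ 2 ≤ f i) (hf : Tendsto f l (𝓝 0)) :
    Tendsto u l (𝓝 0) := by
  have h1 : Tendsto (fun i => ‖u i‖ ^ 2) l (𝓝 0) := by
    refine squeeze_zero (fun i => sq_nonneg _) (fun i => ?_) (by simpa using hf.const_mul α⁻¹)
    rw [← div_eq_inv_mul, le_div_iff₀ hα, mul_comm]
    exact hle i
  have h2 := h1.sqrt
  simp only [Real.sqrt_sq (norm_nonneg _), Real.sqrt_zero] at h2
  exact tendsto_zero_iff_norm_tendsto_zero.2 h2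

end Norm

/-! ### Weak convergence and weak compactness. -/

section WeakConvergence

variable {ι E F : Type*} [NormedAddCommGroup E] [InnerProductSpace ℝ E]
  [NormedAddCommGroup F] [InnerProductSpace ℝ F] {l : Filter ι}

/-- Weak convergence in a real inner product space, tested against the inner product. -/
def WeakTendsto (u : ι → E) (l : Filter ι) (e : E) : Prop :=
  ∀ w, Tendsto (fun i => ⟪u i, w⟫) l (𝓝 ⟪e, w⟫)

theorem tendsto_inner_zero {u w : ι → E} {K : ℝ} (hu : ∀ i, ‖u i‖ ≤ K)
    (hw : Tendsto w l (𝓝 0)) : Tendsto (fun i => ⟪u i, w i⟫) l (𝓝 0) := by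
  refine squeeze_zero_norm (a := fun i => K * ‖w i‖) (fun i => ?_)
    (by simpa using hw.norm.const_mul K)
  exact (norm_inner_le_norm _ _).trans (mul_le_mul_of_nonneg_right (hu i) (norm_nonneg _))

/-- The bound on `u` is an explicit hypothesis because weak convergence along a general filter does
not supply one. -/
theorem WeakTendsto.inner {u w : ι → E} {e v : E} {K : ℝ} (h : WeakTendsto u l e)
    (hu : ∀ i, ‖u i‖ ≤ K) (hw : Tendsto w l (𝓝 v)) :
    Tendsto (fun i => ⟪u i, w i⟫) l (𝓝 ⟪e, v⟫) := by
  have h1 : Tendsto (fun i => w i - v) l (𝓝 0) := by simpa using hw.sub_const v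
  have h2 := (h v).add (tendsto_inner_zero hu h1)
  simpa [inner_sub_right] using h2

theorem WeakTendsto.congr_sub {u u' : ι → E} {e : E} (h : WeakTendsto u l e)
    (hu : Tendsto (fun i => u i - u' i) l (𝓝 0)) : WeakTendsto u' l e := by
  intro w
  have h1 : Tendsto (fun i => ⟪u i - u' i, w⟫) l (𝓝 ⟪(0 : E), w⟫) := hu.inner tendsto_const_nhds
  simpa [inner_sub_left] using (h w).sub h1

theorem WeakTendsto.map [CompleteSpace E] [CompleteSpace F] {u : ι → E} {e : E}
    (h : WeakTendsto u l e) (L : E →L[ℝ] F) : WeakTendsto (fun i => L (u i)) l (L e) := by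
  intro w
  simpa [ContinuousLinearMap.adjoint_inner_right] using h (L.adjoint w)

theorem WeakTendsto.unique [l.NeBot] {u : ι → E} {e e' : E} (h : WeakTendsto u l e)
    (h' : WeakTendsto u l e') : e = e' :=
  ext_inner_right ℝ fun w => tendsto_nhds_unique (h w) (h' w)

/-- Banach–Alaoglu, transported through the Riesz isomorphism. -/
theorem exists_weakTendsto_ultrafilter [CompleteSpace E] (U : Ultrafilter ι) {u : ι → E} {K : ℝ}
    (hu : ∀ i, ‖u i‖ ≤ K) : ∃ e, WeakTendsto u U e := by
  let f : ι → WeakDual ℝ E := fun i => StrongDual.toWeakDual (InnerProductSpace.toDual ℝ E (u i))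
  have hmem : ∀ i, f i ∈ WeakDual.toStrongDual ⁻¹'
      Metric.closedBall (0 : StrongDual ℝ E) K := by
    intro i
    simpa [f] using hu i
  obtain ⟨φ, -, hφ⟩ := (WeakDual.isCompact_closedBall (0 : StrongDual ℝ E) K).ultrafilter_le_nhds
    (U.map f) (by
      rw [le_principal_iff, Ultrafilter.mem_coe, Ultrafilter.mem_map]
      exact Eventually.of_forall hmem)
  refine ⟨(InnerProductSpace.toDual ℝ E).symm (WeakDual.toStrongDual φ), fun w => ?_⟩
  have h1 : Tendsto f U (𝓝 φ) := hφ
  have h2 := ((WeakDual.eval_continuous w).tendsto φ).comp h1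
  simpa [f, Function.comp_def] using h2

theorem WeakTendsto.tendsto_toDual [CompleteSpace E] {u : ι → E} {e : E} (h : WeakTendsto u l e)
    (φ : E →L[ℝ] ℝ) : Tendsto (fun i => φ (u i)) l (𝓝 (φ e)) := by
  have h1 := h ((InnerProductSpace.toDual ℝ E).symm φ)
  simp_rw [real_inner_comm _ (u _)] at h1
  rw [real_inner_comm] at h1
  simpa using h1

theorem WeakTendsto.prodMk {D : Type*} [NormedAddCommGroup D] [InnerProductSpace ℝ D]
    [CompleteSpace D] [CompleteSpace E] [CompleteSpace F] {u : ι → D} {v : ι → E} {w : ι → F}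
    {a : D} {b : E} {c : F} (hu : WeakTendsto u l a) (hv : WeakTendsto v l b)
    (hw : WeakTendsto w l c) :
    Tendsto (fun i => toWeakSpace ℝ (D × E × F) (u i, v i, w i)) l
      (𝓝 (toWeakSpace ℝ (D × E × F) (a, b, c))) := by
  refine (Topology.IsInducing.induced _).tendsto_nhds_iff.2 (tendsto_pi_nhds.2 fun φ => ?_)
  change Tendsto (fun i => φ (u i, v i, w i)) l (𝓝 (φ (a, b, c)))
  have hφ : ∀ p q r, φ (p, q, r) = φ.comp (.inl ℝ D (E × F)) p +
      (φ.comp ((ContinuousLinearMap.inr ℝ D (E × F)).comp (.inl ℝ E F)) q +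
        φ.comp ((ContinuousLinearMap.inr ℝ D (E × F)).comp (.inr ℝ E F)) r) := by
    intro p q r
    simp [← map_add]
  simp_rw [hφ]
  exact (hu.tendsto_toDual _).add ((hv.tendsto_toDual _).add (hw.tendsto_toDual _))

end WeakConvergence

/-! ### Maximal monotonicity and cocoercivity in the limit. -/

section MaximalMonotonicity

variable {E F : Type*} [NormedAddCommGroup E] [InnerProductSpace ℝ E]
  [NormedAddCommGroup F] [InnerProductSpace ℝ F]

/-- Adjoining `(x, u)` to the graph keeps it monotone, so by maximality it was already there. -/
theorem IsMaximallyMonotone.mem_of_forall {A : E → Set E} (hA : IsMaximallyMonotone A) {x u : E}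
    (h : ∀ y, ∀ v ∈ A y, 0 ≤ ⟪x - y, u - v⟫) : u ∈ A x := by
  have hA' := hA.2 (fun y => {v | v ∈ A y ∨ (y = x ∧ v = u)}) ?_ fun y v hv => Or.inl hv
  · have : u ∈ {v | v ∈ A x ∨ (x = x ∧ v = u)} := Or.inr ⟨rfl, rfl⟩
    exact (congrFun hA' x) ▸ this
  · rintro y v y' v' (hv | ⟨rfl, rfl⟩) (hv' | ⟨rfl, rfl⟩)
    · exact hA.1 hv hv'
    · rw [← neg_sub y' y, ← neg_sub v' v, inner_neg_neg]
      exact h y v hv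
    · exact h y' v' hv'
    · simp

/-- The product of two maximally monotone operators is maximally monotone. -/
theorem IsMaximallyMonotone.mem_and_mem_of_forall {A : E → Set E} {B : F → Set F}
    (hA : IsMaximallyMonotone A) (hB : IsMaximallyMonotone B) {x u : E} {z w : F}
    (h : ∀ a, ∀ a' ∈ A a, ∀ b, ∀ b' ∈ B b, 0 ≤ ⟪x - a, u - a'⟫ + ⟪z - b, w - b'⟫) :
    u ∈ A x ∧ w ∈ B z := by
  have hu : u ∈ A x := by
    by_contra hu
    have : ∃ a, ∃ a' ∈ A a, ⟪x - a, u - a'⟫ < 0 := by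
      by_contra! hcon
      exact hu (hA.mem_of_forall hcon)
    obtain ⟨a, a', ha, hneg⟩ := this
    -- A strictly negative `A`-pairing forces every `B`-pairing to be positive; the point `(z, w)`
    -- itself then pairs to zero, a contradiction.
    have hw : w ∈ B z := hB.mem_of_forall fun b b' hb => by linarith [h a a' ha b b' hb]
    have := h a a' ha z w hw
    simp only [sub_self, inner_zero_left] at this
    linarith
  refine ⟨hu, hB.mem_of_forall fun b b' hb => ?_⟩
  simpa using h x u hu b b' hb

/-- If `u k` converges weakly and `C (u k)` strongly, the limits are related by `C`. -/
theorem IsCocoercive.apply_eq_of_weakTendsto {ι : Type*} {l : Filter ι} [l.NeBot] {η : ℝ}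
    {C : E → E} (hη : 0 < η) (hC : IsCocoercive η C) {u : ι → E} {e d : E} {K : ℝ}
    (hu : ∀ i, ‖u i‖ ≤ K) (h : WeakTendsto u l e) (hd : Tendsto (fun i => C (u i)) l (𝓝 d)) :
    C e = d := by
  have h1 : Tendsto (fun i => η * ‖C (u i) - C e‖ ^ 2) l (𝓝 (η * ‖d - C e‖ ^ 2)) :=
    ((hd.sub_const _).norm.pow 2).const_mul η
  have hd' := hd.sub_const (C e)
  have h2 : Tendsto (fun i => ⟪u i - e, C (u i) - C e⟫) l (𝓝 (⟪e, d - C e⟫ - ⟪e, d - C e⟫)) := by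
    simp_rw [inner_sub_left]
    exact (h.inner hu hd').sub (tendsto_const_nhds.inner hd')
  have h3 := le_of_tendsto_of_tendsto' h1 h2 fun i => hC (u i) e
  rw [sub_self] at h3
  have h4 : ‖d - C e‖ ^ 2 = 0 := le_antisymm (nonpos_of_mul_nonpos_right h3 hη) (sq_nonneg _)
  have h5 : d - C e = 0 := by simpa using h4
  exact (sub_eq_zero.1 h5).symm

end MaximalMonotonicity

end MonotoneInclusion

namespace MonotoneInclusion

open scoped RealInnerProductSpace Topology
open Filter

/-! ### The Lyapunov function. -/

section Energy

variable {H G : Type*} [NormedAddCommGroup H] [InnerProductSpace ℝ H]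
  [NormedAddCommGroup G] [InnerProductSpace ℝ G] {c : ℝ}

/-- The Lyapunov function of the algorithm, evaluated at the distance to a solution. -/
noncomputable def energy (c : ℝ) (P : H →L[ℝ] H) (Q : G →L[ℝ] G) (p : H) (r e : G) : ℝ :=
  ⟪p, P p⟫ + ⟪r, Q r⟫ + c * ‖r‖ ^ 2 + c⁻¹ * ‖e‖ ^ 2

theorem energy_mono {P P' : H →L[ℝ] H} {Q Q' : G →L[ℝ] G} (hP : P ≤ P') (hQ : Q ≤ Q')
    (p : H) (r e : G) : energy c P Q p r e ≤ energy c P' Q' p r e := by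
  have h1 := inner_apply_le_of_le hP p
  have h2 := inner_apply_le_of_le hQ r
  simp only [energy]
  linarith

theorem energy_nonneg {P : H →L[ℝ] H} {Q : G →L[ℝ] G} (hc : 0 < c) (hP : P.IsPositive)
    (hQ : Q.IsPositive) (p : H) (r e : G) : 0 ≤ energy c P Q p r e := by
  have h1 := hP.inner_nonneg_right p
  have h2 := hQ.inner_nonneg_right r
  have h3 := inv_pos.2 hc
  simp only [energy]
  positivity

end Energy

/-! ### Descent, asymptotic regularity and identification of the weak limit. -/

section Algorithm

variable {H G : Type*}
  [NormedAddCommGroup H] [InnerProductSpace ℝ H] [CompleteSpace H]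
  [NormedAddCommGroup G] [InnerProductSpace ℝ G] [CompleteSpace G]
  {A : H → Set H} {B : G → Set G} {C : H → H} {L : H →L[ℝ] G} {c η : ℝ}
  {M₁ : ℕ → H →L[ℝ] H} {M₂ : ℕ → G →L[ℝ] G} {x : ℕ → H} {z y : ℕ → G}

theorem IsADMMSequence.mem_A (h : IsADMMSequence A B C L c M₁ M₂ x z y) (k : ℕ) :
    -(L.adjoint (y (k + 1))) + c • L.adjoint (z k - z (k + 1)) + M₁ k (x k - x (k + 1)) - C (x k)
      ∈ A (x (k + 1)) := by
  obtain ⟨u, hu, he⟩ := h.x_step k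
  convert hu using 1
  have hc := h.c_pos.ne'
  rw [h.y_step k]
  simp only [add_apply, smul_apply, ContinuousLinearMap.comp_apply, map_sub, map_add, map_smul,
    smul_sub, smul_smul, mul_inv_cancel₀ hc, one_smul] at he ⊢
  rw [← sub_eq_iff_eq_add'] at he
  rw [← he]
  abel

theorem IsADMMSequence.mem_B (h : IsADMMSequence A B C L c M₁ M₂ x z y) (k : ℕ) :
    y (k + 1) + M₂ k (z k - z (k + 1)) ∈ B (z (k + 1)) := by
  obtain ⟨u, ⟨w, hw, rfl⟩, he⟩ := h.z_step k
  convert hw using 1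
  have hc := h.c_pos.ne'
  have he' := congrArg (c • ·) he
  rw [h.y_step k]
  simp only [add_apply, smul_apply, ContinuousLinearMap.id_apply, map_sub,
    smul_sub, smul_add, smul_smul, mul_inv_cancel₀ hc, one_smul] at he' ⊢
  rw [← sub_eq_iff_eq_add'] at he'
  rw [← he']
  abel

/-- Here `p, r, e` are the errors of the new iterate, `q, t` are old minus new, and `d` is the error
of `C` at the old point `p + q`. The gap between the two sides is exactly twice the sum of the
slacks in `hA`, `hB`, `hC`. -/
theorem energy_descent_of_inner_nonneg {P : H →L[ℝ] H} {Q : G →L[ℝ] G} (hc : 0 < c) (hη : 0 < η)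
    (hP : P.IsPositive) (hQ : Q.IsPositive) {p q d : H} {r t e : G}
    (hA : 0 ≤ ⟪p, -(L.adjoint e) + c • L.adjoint t + P q - d⟫)
    (hB : 0 ≤ ⟪r, e + Q t⟫) (hC : η * ‖d‖ ^ 2 ≤ ⟪p + q, d⟫) :
    energy c P Q p r e + ((⟪q, P q⟫ - 1 / (2 * η) * ‖q‖ ^ 2) + ⟪t, Q t⟫ +
      c * ‖L p - r - t‖ ^ 2 + 2 * η * ‖d - (1 / (2 * η)) • q‖ ^ 2) ≤
      energy c P Q (p + q) (r + t) (e - c • (L p - r)) := by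
  obtain ⟨g, hg⟩ : ∃ g, L p = r + g := ⟨L p - r, by abel⟩
  have e1 : ⟪q, P p⟫ = ⟪p, P q⟫ := by rw [← hP.inner_left_eq_inner_right, real_inner_comm]
  have e2 : ⟪t, Q r⟫ = ⟪r, Q t⟫ := by rw [← hQ.inner_left_eq_inner_right, real_inner_comm]
  have e3 : ⟪t, r⟫ = ⟪r, t⟫ := real_inner_comm _ _
  have e4 : ⟪t, g⟫ = ⟪g, t⟫ := real_inner_comm _ _
  have e5 : ⟪e, g⟫ = ⟪g, e⟫ := real_inner_comm _ _
  have e6 : ⟪d, q⟫ = ⟪q, d⟫ := real_inner_comm _ _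
  simp only [inner_add_right, inner_sub_right, inner_neg_right, real_inner_smul_right,
    ContinuousLinearMap.adjoint_inner_right, hg, inner_add_left] at hA hB hC
  have h1 : r + g - r = g := by abel
  simp only [energy, hg, h1]
  simp only [← real_inner_self_eq_norm_sq, inner_add_right, inner_sub_right, real_inner_smul_right,
    real_inner_smul_left, inner_add_left, inner_sub_left, map_add, e1, e2, e3, e4, e5, e6] at hC ⊢
  have h2 : c⁻¹ * (c * (c * ⟪g, g⟫)) = c * ⟪g, g⟫ := by field_simp
  have h3 : c⁻¹ * (c * ⟪g, e⟫) = ⟪g, e⟫ := by field_simp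
  have h4 : 2 * η * (1 / (2 * η) * (1 / (2 * η) * ⟪q, q⟫)) = 1 / (2 * η) * ⟪q, q⟫ := by field_simp
  have h5 : 2 * η * (1 / (2 * η) * ⟪q, d⟫) = ⟪q, d⟫ := by field_simp
  linarith

theorem IsADMMSequence.energy_descent (h : IsADMMSequence A B C L c M₁ M₂ x z y)
    (hA : IsMonotone A) (hB : IsMonotone B) (hη : 0 < η) (hC : IsCocoercive η C)
    {a : H} {v : G} (hs : IsPrimalDualSolution A B C L a v) (k : ℕ) :
    energy c (M₁ k) (M₂ k) (x (k + 1) - a) (z (k + 1) - L a) (y (k + 1) - v) +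
      ((⟪x k - x (k + 1), M₁ k (x k - x (k + 1))⟫ - 1 / (2 * η) * ‖x k - x (k + 1)‖ ^ 2) +
        ⟪z k - z (k + 1), M₂ k (z k - z (k + 1))⟫ +
        c * ‖L (x (k + 1)) - z k‖ ^ 2 +
        2 * η * ‖C (x k) - C a - (1 / (2 * η)) • (x k - x (k + 1))‖ ^ 2) ≤
      energy c (M₁ k) (M₂ k) (x k - a) (z k - L a) (y k - v) := by
  obtain ⟨⟨u, hu, hue⟩, hv⟩ := hs
  have h1 := hA (h.mem_A k) hu
  have h2 := hB (h.mem_B k) hv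
  have h3 := hC (x k) a
  have hu' : u = -(L.adjoint v) - C a := by rw [hue]; abel
  have key := energy_descent_of_inner_nonneg (L := L) h.c_pos hη (h.M₁_pos k) (h.M₂_pos k)
    (p := x (k + 1) - a) (q := x k - x (k + 1)) (d := C (x k) - C a) (r := z (k + 1) - L a)
    (t := z k - z (k + 1)) (e := y (k + 1) - v)
    (by
      convert h1 using 2
      rw [hu', map_sub L.adjoint (y (k + 1))]
      abel)
    (by
      convert h2 using 2
      abel)
    (by
      convert h3 using 2
      abel)
  have i1 : L (x (k + 1) - a) - (z (k + 1) - L a) - (z k - z (k + 1)) = L (x (k + 1)) - z k := by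
    rw [map_sub]; abel
  have i2 : x (k + 1) - a + (x k - x (k + 1)) = x k - a := by abel
  have i3 : z (k + 1) - L a + (z k - z (k + 1)) = z k - L a := by abel
  have i4 : y (k + 1) - v - c • (L (x (k + 1) - a) - (z (k + 1) - L a)) = y k - v := by
    rw [h.y_step k, map_sub, sub_sub_sub_cancel_right]; abel
  rwa [i1, i2, i3, i4] at key

/-- Fejér monotonicity with respect to the variable metric, and its consequences. -/
theorem IsADMMSequence.tendsto_energy (h : IsADMMSequence A B C L c M₁ M₂ x z y)
    (hA : IsMonotone A) (hB : IsMonotone B) (hη : 0 < η) (hC : IsCocoercive η C)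
    (hM₁ : ∀ k, (M₁ k - (1 / (2 * η)) • ContinuousLinearMap.id ℝ H).IsPositive)
    (hM₁_anti : ∀ k, M₁ (k + 1) ≤ M₁ k) (hM₂_anti : ∀ k, M₂ (k + 1) ≤ M₂ k)
    {a : H} {v : G} (hs : IsPrimalDualSolution A B C L a v) :
    (∃ ℓ, Tendsto (fun k => energy c (M₁ k) (M₂ k) (x k - a) (z k - L a) (y k - v))
      atTop (𝓝 ℓ)) ∧
    (∀ k, energy c (M₁ k) (M₂ k) (x k - a) (z k - L a) (y k - v) ≤
      energy c (M₁ 0) (M₂ 0) (x 0 - a) (z 0 - L a) (y 0 - v)) ∧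
    Tendsto (fun k => ⟪x k - x (k + 1), M₁ k (x k - x (k + 1))⟫ -
      1 / (2 * η) * ‖x k - x (k + 1)‖ ^ 2) atTop (𝓝 0) ∧
    Tendsto (fun k => ⟪z k - z (k + 1), M₂ k (z k - z (k + 1))⟫) atTop (𝓝 0) ∧
    Tendsto (fun k => L (x (k + 1)) - z k) atTop (𝓝 0) ∧
    Tendsto (fun k => C (x k) - C a - (1 / (2 * η)) • (x k - x (k + 1))) atTop (𝓝 0) := by
  set V : ℕ → ℝ := fun k => energy c (M₁ k) (M₂ k) (x k - a) (z k - L a) (y k - v) with hV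
  have hc := h.c_pos
  have hd := h.energy_descent hA hB hη hC hs
  have hm : ∀ k, V (k + 1) ≤ energy c (M₁ k) (M₂ k) (x (k + 1) - a) (z (k + 1) - L a)
      (y (k + 1) - v) := fun k => energy_mono (hM₁_anti k) (hM₂_anti k) _ _ _
  have n1 : ∀ k, 0 ≤ ⟪x k - x (k + 1), M₁ k (x k - x (k + 1))⟫ -
      1 / (2 * η) * ‖x k - x (k + 1)‖ ^ 2 := fun k =>
    sub_nonneg.2 (le_inner_of_sub_smul_id_isPositive (hM₁ k) _)
  have n2 : ∀ k, 0 ≤ ⟪z k - z (k + 1), M₂ k (z k - z (k + 1))⟫ := fun k =>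
    (h.M₂_pos k).inner_nonneg_right _
  have n3 : ∀ k, 0 ≤ c * ‖L (x (k + 1)) - z k‖ ^ 2 := fun k => by positivity
  have n4 : ∀ k, 0 ≤ 2 * η * ‖C (x k) - C a - (1 / (2 * η)) • (x k - x (k + 1))‖ ^ 2 :=
    fun k => by positivity
  have hanti : Antitone V := antitone_nat_of_succ_le fun k => by
    have := hd k; linarith [hm k, n1 k, n2 k, n3 k, n4 k]
  have hlim : Tendsto V atTop (𝓝 (⨅ k, V k)) := tendsto_atTop_ciInf hanti
    ⟨0, by rintro _ ⟨k, rfl⟩; exact energy_nonneg hc (h.M₁_pos k) (h.M₂_pos k) _ _ _⟩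
  have hdiff : Tendsto (fun k => V k - V (k + 1)) atTop (𝓝 0) := by
    simpa using hlim.sub (hlim.comp (tendsto_add_atTop_nat 1))
  refine ⟨⟨_, hlim⟩, fun k => hanti (Nat.zero_le k), ?_, ?_, ?_, ?_⟩
  · exact squeeze_zero n1 (fun k => by linarith [hd k, hm k, n2 k, n3 k, n4 k]) hdiff
  · exact squeeze_zero n2 (fun k => by linarith [hd k, hm k, n1 k, n3 k, n4 k]) hdiff
  · exact tendsto_zero_of_mul_norm_sq_le hc
      (fun k => by linarith [hd k, hm k, n1 k, n2 k, n4 k]) hdiff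
  · exact tendsto_zero_of_mul_norm_sq_le (α := 2 * η) (by positivity)
      (fun k => by linarith [hd k, hm k, n1 k, n2 k, n3 k]) hdiff

/-- Under either strong positivity assumption, consecutive iterates approach each other. -/
theorem tendsto_sub_succ_zero
    (h1 : Tendsto (fun k => ⟪x k - x (k + 1), M₁ k (x k - x (k + 1))⟫ -
      1 / (2 * η) * ‖x k - x (k + 1)‖ ^ 2) atTop (𝓝 0))
    (h2 : Tendsto (fun k => ⟪z k - z (k + 1), M₂ k (z k - z (k + 1))⟫) atTop (𝓝 0))
    (h3 : Tendsto (fun k => L (x (k + 1)) - z k) atTop (𝓝 0))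
    (h : (∃ α₁ > 0, ∀ k, IsUniformlyPositive α₁
            (M₁ k - (1 / (2 * η)) • ContinuousLinearMap.id ℝ H)) ∨
         (∃ α > 0, ∃ α₂ > 0, IsUniformlyPositive α (L.adjoint ∘L L) ∧
            ∀ k, IsUniformlyPositive α₂ (M₂ k))) :
    Tendsto (fun k => x k - x (k + 1)) atTop (𝓝 0) ∧
      Tendsto (fun k => z k - z (k + 1)) atTop (𝓝 0) := by
  have h3' := h3.comp (tendsto_add_atTop_nat 1)
  rcases h with ⟨α₁, hα₁, hP⟩ | ⟨α, hα, α₂, hα₂, hL, hQ⟩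
  · have hx : Tendsto (fun k => x k - x (k + 1)) atTop (𝓝 0) := by
      refine tendsto_zero_of_mul_norm_sq_le hα₁ (fun k => ?_) h1
      have := le_inner_of_sub_smul_id_isPositive ((ContinuousLinearMap.le_def _ _).1 (hP k).2)
        (x k - x (k + 1))
      simpa [inner_sub_right, real_inner_smul_right] using this
    refine ⟨hx, ?_⟩
    have hLx := (L.continuous.tendsto 0).comp (hx.comp (tendsto_add_atTop_nat 1))
    rw [map_zero] at hLx
    -- `z k - z (k + 1)` is the difference of two consecutive residuals plus `L (x (k + 1) - x (k +
    -- 2))`.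
    have := (h3'.sub h3).add hLx
    simp only [sub_zero, add_zero] at this
    refine this.congr fun k => ?_
    simp only [Function.comp_apply, map_sub]
    abel
  · have hz : Tendsto (fun k => z k - z (k + 1)) atTop (𝓝 0) :=
      tendsto_zero_of_mul_norm_sq_le hα₂ (fun k => le_inner_of_sub_smul_id_isPositive
        ((ContinuousLinearMap.le_def _ _).1 (hQ k).2) _) h2
    refine ⟨?_, hz⟩
    have hLx : Tendsto (fun k => L (x (k + 1) - x (k + 2))) atTop (𝓝 0) := by
      have := (h3.sub h3').add hz
      simp only [sub_zero, add_zero] at this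
      refine this.congr fun k => ?_
      simp only [Function.comp_apply, map_sub]
      abel
    have hx : Tendsto (fun k => x (k + 1) - x (k + 2)) atTop (𝓝 0) := by
      refine tendsto_zero_of_mul_norm_sq_le hα (fun k => ?_)
        (by simpa only [norm_zero, zero_pow two_ne_zero] using hLx.norm.pow 2)
      have := le_inner_of_sub_smul_id_isPositive ((ContinuousLinearMap.le_def _ _).1 hL.2)
        (x (k + 1) - x (k + 2))
      rwa [ContinuousLinearMap.comp_apply, ContinuousLinearMap.adjoint_inner_right,
        real_inner_self_eq_norm_sq] at this
    exact (tendsto_add_atTop_iff_nat 1).1 hx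

theorem IsADMMSequence.exists_norm_le (h : IsADMMSequence A B C L c M₁ M₂ x z y) (hη : 0 < η)
    (hM₁ : ∀ k, (M₁ k - (1 / (2 * η)) • ContinuousLinearMap.id ℝ H).IsPositive)
    {a : H} {v : G} {R : ℝ}
    (hR : ∀ k, energy c (M₁ k) (M₂ k) (x k - a) (z k - L a) (y k - v) ≤ R) :
    ∃ K, ∀ k, ‖x k‖ ≤ K ∧ ‖z k‖ ≤ K ∧ ‖y k‖ ≤ K := by
  have hc := h.c_pos
  have hη' : 0 < 1 / (2 * η) := by positivity
  have hc' := inv_pos.2 hc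
  refine ⟨(√(R / (1 / (2 * η))) + ‖a‖) + (√(R / c) + ‖L a‖) + (√(R / c⁻¹) + ‖v‖), fun k => ?_⟩
  have h1 := le_inner_of_sub_smul_id_isPositive (hM₁ k) (x k - a)
  have h2 := (h.M₂_pos k).inner_nonneg_right (z k - L a)
  have h3 := hR k
  simp only [energy] at h3
  have p1 : 0 ≤ 1 / (2 * η) * ‖x k - a‖ ^ 2 := by positivity
  have p2 : 0 ≤ c * ‖z k - L a‖ ^ 2 := by positivity
  have p3 : 0 ≤ c⁻¹ * ‖y k - v‖ ^ 2 := by positivity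
  have b1 := norm_le_of_mul_norm_sub_sq_le (R := R) hη' (u := x k) (e := a) (by linarith)
  have b2 := norm_le_of_mul_norm_sub_sq_le (R := R) hc (u := z k) (e := L a) (by linarith)
  have b3 := norm_le_of_mul_norm_sub_sq_le (R := R) hc' (u := y k) (e := v) (by linarith)
  have q1 : 0 ≤ √(R / (1 / (2 * η))) + ‖a‖ := by positivity
  have q2 : 0 ≤ √(R / c) + ‖L a‖ := by positivity
  have q3 : 0 ≤ √(R / c⁻¹) + ‖v‖ := by positivity
  exact ⟨by linarith, by linarith, by linarith⟩

/-- Weak limits of the iterates are primal-dual solutions. -/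
theorem IsADMMSequence.isPrimalDualSolution_of_weakTendsto
    (h : IsADMMSequence A B C L c M₁ M₂ x z y)
    (hA : IsMaximallyMonotone A) (hB : IsMaximallyMonotone B) (hη : 0 < η)
    (hC : IsCocoercive η C) (hM₁_anti : Antitone M₁) (hM₂_anti : Antitone M₂) {K : ℝ}
    (hK : ∀ k, ‖x k‖ ≤ K ∧ ‖z k‖ ≤ K ∧ ‖y k‖ ≤ K)
    (hx : Tendsto (fun k => x k - x (k + 1)) atTop (𝓝 0))
    (hz : Tendsto (fun k => z k - z (k + 1)) atTop (𝓝 0))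
    (hLx : Tendsto (fun k => L (x (k + 1)) - z k) atTop (𝓝 0))
    {d : H} (hd : Tendsto (fun k => C (x k)) atTop (𝓝 d))
    {l : Filter ℕ} [l.NeBot] (hl : l ≤ atTop) {a : H} {b v : G}
    (ha : WeakTendsto x l a) (hb : WeakTendsto z l b) (hv : WeakTendsto y l v) :
    b = L a ∧ IsPrimalDualSolution A B C L a v := by
  have ha' : WeakTendsto (fun k => x (k + 1)) l a := ha.congr_sub (hx.mono_left hl)
  have hb' : WeakTendsto (fun k => z (k + 1)) l b := hb.congr_sub (hz.mono_left hl)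
  have hgap : Tendsto (fun k => L (x (k + 1)) - z (k + 1)) atTop (𝓝 0) := by
    simpa using hLx.add hz
  have hv' : WeakTendsto (fun k => y (k + 1)) l v := by
    refine hv.congr_sub (Tendsto.mono_left ?_ hl)
    have := hgap.const_smul (-c)
    rw [smul_zero] at this
    refine this.congr fun k => ?_
    rw [h.y_step k, neg_smul]
    abel
  have hba : b = L a := by
    refine (hb'.unique ((ha'.map L).congr_sub (hgap.mono_left hl)))
  have hCa : C a = d :=
    hC.apply_eq_of_weakTendsto hη (fun k => (hK k).1) ha (hd.mono_left hl)
  have hs : Tendsto (fun k => c • L.adjoint (z k - z (k + 1)) + M₁ k (x k - x (k + 1)) - C (x k))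
      l (𝓝 (-d)) := by
    have h1 := (L.adjoint.continuous.tendsto 0).comp hz
    rw [map_zero] at h1
    have := ((h1.const_smul c).add (tendsto_apply_zero_of_antitone h.M₁_pos hM₁_anti hx)).sub hd
    simp only [smul_zero, zero_add, zero_sub] at this
    exact this.mono_left hl
  have ht : Tendsto (fun k => M₂ k (z k - z (k + 1))) l (𝓝 0) :=
    (tendsto_apply_zero_of_antitone h.M₂_pos hM₂_anti hz).mono_left hl
  -- Separately, the two inequalities contain products of two weakly convergent sequences. In their
  -- sum these combine into `⟪y (k + 1), L (x (k + 1)) - z (k + 1)⟫`, bounded against strongly null;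
  -- hence both operators are treated jointly.
  have hmem : -(L.adjoint v) - d ∈ A a ∧ v ∈ B b := by
    refine hA.mem_and_mem_of_forall hB fun p u hu q w hw => ?_
    have hs' := hs.sub_const u
    have ht' := ht.sub_const w
    have l1 := ha'.inner (fun k => (hK (k + 1)).1) hs'
    have l2 : Tendsto _ l (𝓝 ⟪p, -d - u⟫) := tendsto_const_nhds.inner hs'
    have l3 := hv' (L p - q)
    have l4 := (tendsto_inner_zero (fun k => (hK (k + 1)).2.2) hgap).mono_left hl
    have l5 := hb'.inner (fun k => (hK (k + 1)).2.1) ht'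
    have l6 : Tendsto _ l (𝓝 ⟪q, 0 - w⟫) := tendsto_const_nhds.inner ht'
    have key := ge_of_tendsto' (((((l1.sub l2).add l3).sub l4).add l5).sub l6) (b := 0)
      fun k => by
        have m1 := hA.1 (h.mem_A k) hu
        have m2 := hB.1 (h.mem_B k) hw
        have m := add_nonneg m1 m2
        refine m.trans_eq ?_
        have c1 := real_inner_comm (y (k + 1)) (L (x (k + 1)))
        have c2 := real_inner_comm (y (k + 1)) (z (k + 1))
        have c3 := real_inner_comm (y (k + 1)) (L p)
        have c4 := real_inner_comm (y (k + 1)) q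
        simp only [inner_sub_left, inner_sub_right, inner_add_right, inner_neg_right,
          ContinuousLinearMap.adjoint_inner_right, map_sub L]
        linarith
    refine key.trans_eq ?_
    have c3 := real_inner_comm v (L p)
    have c4 := real_inner_comm v q
    subst hba
    simp only [inner_sub_left, inner_sub_right, inner_neg_right, inner_zero_right,
      ContinuousLinearMap.adjoint_inner_right, map_sub L]
    linarith
  refine ⟨hba, ⟨_, hmem.1, ?_⟩, hba ▸ hmem.2⟩
  rw [hCa]
  abel

/-- Two weak limits along subfilters for which the energies of both limits converge coincide:
the variable-metric form of Opial's lemma. -/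
theorem weak_limits_eq_of_tendsto_energy (hc : 0 < c) (hη : 0 < η)
    (hM₁ : ∀ k, (M₁ k - (1 / (2 * η)) • ContinuousLinearMap.id ℝ H).IsPositive)
    (hM₁_pos : ∀ k, (M₁ k).IsPositive) (hM₂_pos : ∀ k, (M₂ k).IsPositive)
    (hM₁_anti : Antitone M₁) (hM₂_anti : Antitone M₂) {K : ℝ}
    (hK : ∀ k, ‖x k‖ ≤ K ∧ ‖z k‖ ≤ K ∧ ‖y k‖ ≤ K)
    {l l' : Filter ℕ} [l.NeBot] [l'.NeBot] (hl : l ≤ atTop) (hl' : l' ≤ atTop)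
    {a a' : H} {b b' v v' : G}
    (ha : WeakTendsto x l a) (hb : WeakTendsto z l b) (hv : WeakTendsto y l v)
    (ha' : WeakTendsto x l' a') (hb' : WeakTendsto z l' b') (hv' : WeakTendsto y l' v')
    {ℓ ℓ' : ℝ}
    (he : Tendsto (fun k => energy c (M₁ k) (M₂ k) (x k - a) (z k - b) (y k - v)) atTop (𝓝 ℓ))
    (he' : Tendsto (fun k => energy c (M₁ k) (M₂ k) (x k - a') (z k - b') (y k - v'))
      atTop (𝓝 ℓ')) :
    a = a' ∧ b = b' ∧ v = v' := by
  obtain ⟨p, hp⟩ := exists_tendsto_apply_of_antitone hM₁_pos hM₁_anti (a' - a)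
  obtain ⟨q, hq⟩ := exists_tendsto_apply_of_antitone hM₂_pos hM₂_anti (b' - b)
  have hmid₁ : Tendsto (fun k => ⟪a + a', M₁ k (a' - a)⟫) atTop (𝓝 ⟪a + a', p⟫) :=
    tendsto_const_nhds.inner hp
  have hmid₂ : Tendsto (fun k => ⟪b + b', M₂ k (b' - b)⟫) atTop (𝓝 ⟪b + b', q⟫) :=
    tendsto_const_nhds.inner hq
  -- Terms quadratic in the iterate cancel between the two energies, leaving a linear expression
  -- that converges along all of `atTop`.
  have hlin : Tendsto (fun k => ⟪x k, M₁ k (a' - a)⟫ + ⟪z k, M₂ k (b' - b)⟫ +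
      c * ⟪z k, b' - b⟫ + c⁻¹ * ⟪y k, v' - v⟫) atTop
      (𝓝 ((ℓ - ℓ' + ⟪a + a', p⟫ + ⟪b + b', q⟫ + c * (‖b'‖ ^ 2 - ‖b‖ ^ 2) +
        c⁻¹ * (‖v'‖ ^ 2 - ‖v‖ ^ 2)) / 2)) := by
    refine ((((((he.sub he').add hmid₁).add hmid₂).add_const _).add_const _).div_const 2).congr
      fun k => ?_
    have e1 : ∀ u w : H, ⟪u, M₁ k w⟫ = ⟪w, M₁ k u⟫ := fun u w => by
      rw [← (hM₁_pos k).inner_left_eq_inner_right, real_inner_comm]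
    have e2 : ∀ u w : G, ⟪u, M₂ k w⟫ = ⟪w, M₂ k u⟫ := fun u w => by
      rw [← (hM₂_pos k).inner_left_eq_inner_right, real_inner_comm]
    simp only [energy, norm_sub_sq_real, map_sub, inner_sub_left, inner_sub_right,
      inner_add_left, e1 a (x k), e1 a' (x k), e2 b (z k), e2 b' (z k), e1 a' a, e2 b' b]
    ring
  have hlim : ∀ {m : Filter ℕ} [m.NeBot] {a₀ : H} {b₀ v₀ : G}, m ≤ atTop →
      WeakTendsto x m a₀ → WeakTendsto z m b₀ → WeakTendsto y m v₀ →
      ⟪a₀, p⟫ + ⟪b₀, q⟫ + c * ⟪b₀, b' - b⟫ + c⁻¹ * ⟪v₀, v' - v⟫ =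
        (ℓ - ℓ' + ⟪a + a', p⟫ + ⟪b + b', q⟫ + c * (‖b'‖ ^ 2 - ‖b‖ ^ 2) +
          c⁻¹ * (‖v'‖ ^ 2 - ‖v‖ ^ 2)) / 2 := fun hm h₁ h₂ h₃ =>
    tendsto_nhds_unique ((((h₁.inner (fun k => (hK k).1) (hp.mono_left hm)).add
      (h₂.inner (fun k => (hK k).2.1) (hq.mono_left hm))).add ((h₂ _).const_mul c)).add
      ((h₃ _).const_mul c⁻¹)) (hlin.mono_left hm)
  have heq := (hlim hl' ha' hb' hv').trans (hlim hl ha hb hv).symm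
  have hp_le : 1 / (2 * η) * ‖a' - a‖ ^ 2 ≤ ⟪a' - a, p⟫ :=
    ge_of_tendsto' (tendsto_const_nhds.inner hp) fun k =>
      le_inner_of_sub_smul_id_isPositive (hM₁ k) _
  have hq_le : 0 ≤ ⟪b' - b, q⟫ :=
    ge_of_tendsto' (tendsto_const_nhds.inner hq) fun k => (hM₂_pos k).inner_nonneg_right _
  -- The linear expression has the same limit along `l` and `l'`; subtracting gives a vanishing sum
  -- of nonnegative terms.
  have hsum : ⟪a' - a, p⟫ + ⟪b' - b, q⟫ + c * ‖b' - b‖ ^ 2 + c⁻¹ * ‖v' - v‖ ^ 2 = 0 := by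
    simp only [← real_inner_self_eq_norm_sq, inner_sub_left (𝕜 := ℝ) a', inner_sub_left b' b,
      inner_sub_left v' v]
    linarith
  have eq_of_le : ∀ {α s : ℝ}, 0 < α → 0 ≤ s → α * s ≤ 0 → s = 0 := fun hα hs h =>
    le_antisymm (nonpos_of_mul_nonpos_right h hα) hs
  have hη' : 0 < 1 / (2 * η) := by positivity
  have hc' := inv_pos.2 hc
  have p1 := mul_nonneg hη'.le (sq_nonneg ‖a' - a‖)
  have p2 := mul_nonneg hc.le (sq_nonneg ‖b' - b‖)
  have p3 := mul_nonneg hc'.le (sq_nonneg ‖v' - v‖)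
  have z1 := eq_of_le hη' (sq_nonneg ‖a' - a‖) (by linarith)
  have z2 := eq_of_le hc (sq_nonneg ‖b' - b‖) (by linarith)
  have z3 := eq_of_le hc' (sq_nonneg ‖v' - v‖) (by linarith)
  simp only [ne_eq, OfNat.ofNat_ne_zero, not_false_eq_true, pow_eq_zero_iff, norm_eq_zero,
    sub_eq_zero] at z1 z2 z3
  exact ⟨z1.symm, z2.symm, z3.symm⟩

end Algorithm

end MonotoneInclusion

theorem theorem1 {H G : Type*}
    [NormedAddCommGroup H] [InnerProductSpace ℝ H] [CompleteSpace H]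
    [NormedAddCommGroup G] [InnerProductSpace ℝ G] [CompleteSpace G]
    (A : H → Set H) (B : G → Set G) (C : H → H) (L : H →L[ℝ] G) (η : ℝ)
    (hA : MonotoneInclusion.IsMaximallyMonotone A)
    (hB : MonotoneInclusion.IsMaximallyMonotone B)
    (hη : 0 < η) (hC : MonotoneInclusion.IsCocoercive η C)
    (hsol : ∃ (x : H) (v : G), MonotoneInclusion.IsPrimalDualSolution A B C L x v)
    (c : ℝ) (M₁ : ℕ → H →L[ℝ] H) (M₂ : ℕ → G →L[ℝ] G)
    (x : ℕ → H) (z y : ℕ → G)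
    (hseq : MonotoneInclusion.IsADMMSequence A B C L c M₁ M₂ x z y)
    (hM₁ : ∀ k, (M₁ k - (1 / (2 * η)) • ContinuousLinearMap.id ℝ H).IsPositive)
    (hM₁_anti : ∀ k, M₁ (k + 1) ≤ M₁ k)
    (hM₂_anti : ∀ k, M₂ (k + 1) ≤ M₂ k)
    (h : (∃ α₁ > 0, ∀ k, MonotoneInclusion.IsUniformlyPositive α₁
            (M₁ k - (1 / (2 * η)) • ContinuousLinearMap.id ℝ H)) ∨
         (∃ α > 0, ∃ α₂ > 0, MonotoneInclusion.IsUniformlyPositive α (L.adjoint ∘L L) ∧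
            ∀ k, MonotoneInclusion.IsUniformlyPositive α₂ (M₂ k))) :
    ∃ (xbar : H) (v : G), MonotoneInclusion.IsPrimalDualSolution A B C L xbar v ∧
      Filter.Tendsto (fun k => toWeakSpace ℝ (H × G × G) (x k, z k, y k)) Filter.atTop
        (nhds (toWeakSpace ℝ (H × G × G) (xbar, L xbar, v))) := by
  obtain ⟨a₀, v₀, hs₀⟩ := hsol
  have hanti₁ : Antitone M₁ := antitone_nat_of_succ_le hM₁_anti
  have hanti₂ : Antitone M₂ := antitone_nat_of_succ_le hM₂_anti
  have henergy := fun (a : H) (v : G) hs =>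
    hseq.tendsto_energy hA.1 hB.1 hη hC hM₁ hM₁_anti hM₂_anti (a := a) (v := v) hs
  obtain ⟨-, hbd, hdx, hdz, hLx, hdC⟩ := henergy a₀ v₀ hs₀
  obtain ⟨hx, hz⟩ := MonotoneInclusion.tendsto_sub_succ_zero hdx hdz hLx h
  obtain ⟨K, hK⟩ := hseq.exists_norm_le hη hM₁ hbd
  have hCx : Filter.Tendsto (fun k => C (x k)) Filter.atTop (nhds (C a₀)) := by
    simpa using (hdC.add (hx.const_smul (1 / (2 * η)))).add_const (C a₀)
  have hlim : ∀ U : Ultrafilter ℕ, (U : Filter ℕ) ≤ Filter.atTop → ∃ a v,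
      MonotoneInclusion.IsPrimalDualSolution A B C L a v ∧
      MonotoneInclusion.WeakTendsto x U a ∧ MonotoneInclusion.WeakTendsto z U (L a) ∧
      MonotoneInclusion.WeakTendsto y U v := by
    intro U hU
    obtain ⟨a, ha⟩ := MonotoneInclusion.exists_weakTendsto_ultrafilter U fun k => (hK k).1
    obtain ⟨b, hb⟩ := MonotoneInclusion.exists_weakTendsto_ultrafilter U fun k => (hK k).2.1
    obtain ⟨v, hv⟩ := MonotoneInclusion.exists_weakTendsto_ultrafilter U fun k => (hK k).2.2
    obtain ⟨rfl, hs⟩ := hseq.isPrimalDualSolution_of_weakTendsto hA hB hη hC hanti₁ hanti₂ hK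
      hx hz hLx hCx hU ha hb hv
    exact ⟨a, v, hs, ha, hb, hv⟩
  -- Any ultrafilter below `atTop` provides the candidate limit; every other one is then compared
  -- with it.
  obtain ⟨a, v, hs, ha, hb, hv⟩ := hlim (Filter.hyperfilter ℕ)
    (Filter.hyperfilter_le_cofinite.trans_eq Nat.cofinite_eq_atTop)
  refine ⟨a, v, hs, (Filter.tendsto_iff_ultrafilter _ _ _).2 fun U hU => ?_⟩
  obtain ⟨a', v', hs', ha', hb', hv'⟩ := hlim U hU
  obtain ⟨_, he⟩ := (henergy a v hs).1
  obtain ⟨_, he'⟩ := (henergy a' v' hs').1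
  obtain ⟨rfl, -, rfl⟩ := MonotoneInclusion.weak_limits_eq_of_tendsto_energy hseq.c_pos hη hM₁
    hseq.M₁_pos hseq.M₂_pos hanti₁ hanti₂ hK
    (Filter.hyperfilter_le_cofinite.trans_eq Nat.cofinite_eq_atTop) hU ha hb hv ha' hb' hv' he he'
  exact ha'.prodMk hb' hv'
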